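/- Let $\Bbbk$ be a field; all algebras below are associative unital $\Bbbk$-algebras, and all algebra homomorphisms are unital and $\Bbbk$-linear. For an algebra $A$ write $A[t_1,\dots,t_n]$ for the polynomial extension of $A$ by commuting variables that commute with $A$, and $M(A)$ for the $\Bbbk$-linear abelian category of right $A$-modules. Equivalences between such categories are understood to be $\Bbbk$-linear. An algebra $A$ is called - strongly retractable if for every $n\ge 1$, every algebra $B$ and every algebra isomorphism $\phi\colon A[s_1,\dots,s_n]\to B[t_1,\dots,t_n]$ one has $\phi(A)=B$; - strongly detectable if for every $n\ge 1$, every algebra $B$ and every algebra isomorphism $\phi\colon A[s_1,\dots,s_n]\to B[t_1,\dots,t_n]$, the algebra $B[t_1,\dots,t_n]$ is generated by $B$ and $\phi(s_1),\dots,\phi(s_n)$; - strongly cancellative if for every $n\ge 1$ and every algebra $B$, an algebra isomorphism $A[s_1,\dots,s_n]\cong B[t_1,\dots,t_n]$ implies that $A\cong B$ as algebras; - strongly Morita cancellative if for every $n\ge 1$ and every algebra $B$, an equivalence $M(A[s_1,\dots,s_n])\simeq M(B[t_1,\dots,t_n])$ implies an equivalence $M(A)\simeq M(B)$. **Theorem.**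 Let $A$ be an algebra with center $Z$, and let $N(Z)$ be the nilradical of $Z$. Suppose that either 1. $Z$ or $Z/N(Z)$ is strongly retractable, or 2. $Z$ or $Z/N(Z)$ is strongly detectable. Then both $Z$ and $A$ are strongly cancellative and strongly Morita cancellative. -/

import Mathlib

universe u v

/-- The polynomial extension `A[t₁, …, tₙ]` of a (not necessarily commutative) ring `A` by `n`
commuting variables that commute with the elements of `A`: the monoid algebra over `A` of the
additive monoid of exponent vectors. For commutative `A` this is `MvPolynomial (Fin n) A`. -/
abbrev PolyExt (n : ℕ) (A : Type u) [Ring A] : Type u :=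
  AddMonoidAlgebra A (Fin n →₀ ℕ)

namespace PolyExt

/-- The variable `tᵢ` of `A[t₁, …, tₙ]`. -/
noncomputable def var (n : ℕ) (A : Type u) [Ring A] (i : Fin n) : PolyExt n A :=
  AddMonoidAlgebra.single (Finsupp.single i 1) 1

/-- The copy of `A` inside `A[t₁, …, tₙ]`, that is, the constant polynomials, as a
`k`-subalgebra. -/
noncomputable def const (k : Type v) [Field k] (n : ℕ) (A : Type u) [Ring A] [Algebra k A] :
    Subalgebra k (PolyExt n A) :=
  (AddMonoidAlgebra.singleZeroAlgHom : A →ₐ[k] PolyExt n A).range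

end PolyExt

/-- `A` is strongly retractable: every `k`-algebra isomorphism
`φ : A[s₁, …, sₙ] ≅ B[t₁, …, tₙ]` with `n ≥ 1` satisfies `φ(A) = B`. -/
def StronglyRetractable (k : Type v) [Field k] (A : Type u) [Ring A] [Algebra k A] : Prop :=
  ∀ (n : ℕ), 1 ≤ n → ∀ (B : Type u) [Ring B] [Algebra k B]
    (φ : PolyExt n A ≃ₐ[k] PolyExt n B),
    (PolyExt.const k n A).map (φ : PolyExt n A →ₐ[k] PolyExt n B) = PolyExt.const k n B

/-- `A` is strongly detectable: for every `k`-algebra isomorphism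
`φ : A[s₁, …, sₙ] ≅ B[t₁, …, tₙ]` with `n ≥ 1`, the algebra `B[t₁, …, tₙ]` is generated
by `B` together with `φ(s₁), …, φ(sₙ)`. -/
def StronglyDetectable (k : Type v) [Field k] (A : Type u) [Ring A] [Algebra k A] : Prop :=
  ∀ (n : ℕ), 1 ≤ n → ∀ (B : Type u) [Ring B] [Algebra k B]
    (φ : PolyExt n A ≃ₐ[k] PolyExt n B),
    Algebra.adjoin k ((PolyExt.const k n B : Set (PolyExt n B)) ∪
      Set.range (fun i : Fin n => φ (PolyExt.var n A i))) = ⊤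

/-- `A` is strongly cancellative: a `k`-algebra isomorphism
`A[s₁, …, sₙ] ≅ B[t₁, …, tₙ]` with `n ≥ 1` implies `A ≅ B` as `k`-algebras. -/
def StronglyCancellative (k : Type v) [Field k] (A : Type u) [Ring A] [Algebra k A] : Prop :=
  ∀ (n : ℕ), 1 ≤ n → ∀ (B : Type u) [Ring B] [Algebra k B],
    Nonempty (PolyExt n A ≃ₐ[k] PolyExt n B) → Nonempty (A ≃ₐ[k] B)

/-- The categories `M(A)` and `M(B)` of right modules are equivalent, as `k`-linear abelian
categories. A right `A`-module is a module over the opposite algebra `Aᵐᵒᵖ`. -/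
def RightModuleCatsEquivalent (k : Type v) [Field k] (A B : Type u)
    [Ring A] [Algebra k A] [Ring B] [Algebra k B] : Prop :=
  IsMoritaEquivalent k (MulOpposite A) (MulOpposite B)

/-- `A` is strongly Morita cancellative: an equivalence
`M(A[s₁, …, sₙ]) ≌ M(B[t₁, …, tₙ])` with `n ≥ 1` implies an equivalence `M(A) ≌ M(B)`. -/
def StronglyMoritaCancellative (k : Type v) [Field k] (A : Type u) [Ring A] [Algebra k A] :
    Prop :=
  ∀ (n : ℕ), 1 ≤ n → ∀ (B : Type u) [Ring B] [Algebra k B],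
    RightModuleCatsEquivalent k (PolyExt n A) (PolyExt n B) → RightModuleCatsEquivalent k A B

-- Everything reduces to one property of the center Z (`DetectableAmongCommutative`): for
-- commutative C and an isomorphism φ : Z[s] ≅ C[t], the φ(sᵢ) generate C[t] over C. Retractability
-- implies detectability, and generation modulo nilpotents lifts by a Nakayama argument
-- (`subalgebra_eq_top_of_sub_isNilpotent`), which covers Z/N(Z).
--
-- An isomorphism or a Morita equivalence between A[s] and B[t] induces an isomorphism of centers
-- Z(A)[s] ≅ Z(B)[t]; take this as φ, with C = Z(B). Then tᵢ ↦ φ(sᵢ) is a surjective C-endomorphism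
-- of C[t], hence bijective by reduction to a Noetherian ring, and it extends to an automorphism ψ
-- of B[t] (`exists_algEquiv_map_var`).
--
-- An isomorphism A[s] ≅ B[t] followed by ψ⁻¹ matches the variables, and killing them gives A ≅ B. A
-- Morita equivalence matches the modules killed by the sᵢ with those killed by the ψ(tᵢ), and these
-- form M(A) and M(B).

universe w

open CategoryTheory

/-! ### Commutative polynomial rings: invertible substitutions and generation modulo nilpotents. -/

/-- A surjective endomorphism of a Noetherian commutative ring is injective. -/
theorem RingHom.injective_of_surjective_of_isNoetherianRing {R : Type*} [CommRing R]
    [IsNoetherianRing R] (f : R →+* R) (hf : Function.Surjective f) : Function.Injective f := by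
  -- The iterated preimages of `⊥` are the kernels of the powers of `f`. Once this chain is
  -- stationary, injectivity of `Ideal.comap f` on ideals cancels the iterates, leaving `⊥ = ker f`.
  have hcomap : ∀ m : ℕ, (Ideal.comap f)^[m] ⊥ ≤ (Ideal.comap f)^[m + 1] ⊥ := by
    intro m
    induction m with
    | zero => exact bot_le
    | succ m ih =>
      rw [Function.iterate_succ_apply', Function.iterate_succ_apply' (n := m + 1)]
      exact Ideal.comap_mono ih
  obtain ⟨m, hm⟩ := monotone_stabilizes_iff_noetherian.mpr
    (inferInstance : IsNoetherian R R)
    ⟨fun m ↦ (Ideal.comap f)^[m] ⊥, monotone_nat_of_le_succ hcomap⟩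
  have hinj := (Ideal.comap_injective_of_surjective f hf).iterate m
  have h := hm (m + 1) m.le_succ
  simp only [OrderHom.coe_mk, Function.iterate_succ_apply] at h
  have h' := hinj h
  rw [RingHom.injective_iff_ker_eq_bot, RingHom.ker_eq_comap_bot]
  exact h'.symm

namespace MvPolynomial

/-- A polynomial substitution in finitely many variables that has a right inverse is injective. -/
theorem aeval_injective_of_aeval_eq_X {σ C : Type*} [Finite σ] [CommRing C]
    (s w : σ → MvPolynomial σ C) (h : ∀ i, aeval s (w i) = X i) :
    Function.Injective (aeval (R := C) s) := by
  cases nonempty_fintype σ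
  classical
  rw [injective_iff_map_eq_zero]
  intro p hp
  -- `C` need not be Noetherian, so the data descend to a finitely generated ring `C₀`. The
  -- coefficients of `w` are included to keep the substitution surjective over `C₀`.
  let T : Finset C := (Finset.univ.biUnion fun i ↦ (s i).coeffs ∪ (w i).coeffs) ∪ p.coeffs
  let C₀ := Algebra.adjoin ℤ (T : Set C)
  have : IsNoetherianRing C₀ := by
    have : Algebra.FiniteType ℤ C₀ :=
      (Subalgebra.fg_iff_finiteType _).mp (Subalgebra.fg_adjoin_finset T)
    exact Algebra.FiniteType.isNoetherianRing ℤ C₀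
  let j : C₀ →+* C := C₀.val
  have hj : Function.Injective j := Subtype.val_injective
  have hlift : ∀ q : MvPolynomial σ C, q.coeffs ⊆ T → ∃ q₀, map j q₀ = q := by
    intro q hq
    refine mem_range_map_iff_coeffs_subset.mpr fun c hc ↦ ?_
    exact ⟨⟨c, Algebra.subset_adjoin (hq hc)⟩, rfl⟩
  choose s₀ hs₀ using fun i ↦ hlift (s i) (by
    intro c hc
    simp only [T, Finset.mem_union, Finset.mem_biUnion]
    exact Or.inl ⟨i, by simp, .inl hc⟩)
  choose w₀ hw₀ using fun i ↦ hlift (w i) (by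
    intro c hc
    simp only [T, Finset.mem_union, Finset.mem_biUnion]
    exact Or.inl ⟨i, by simp, .inr hc⟩)
  obtain ⟨p₀, hp₀⟩ := hlift p Finset.subset_union_right
  have hcomm : ∀ q, map j (aeval s₀ q) = aeval s (map j q) := by
    intro q
    induction q using MvPolynomial.induction_on with
    | C a => simp [algHom_C, algebraMap_eq]
    | add a b ha hb => simp only [map_add, ha, hb]
    | mul_X a i ha => simp only [map_mul, ha, map_X, aeval_X, hs₀]
  have hsurj : Function.Surjective (aeval (R := C₀) s₀) := by
    rw [← AlgHom.range_eq_top, ← top_le_iff, ← adjoin_range_X, Algebra.adjoin_le_iff]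
    rintro _ ⟨i, rfl⟩
    refine ⟨w₀ i, map_injective j hj ?_⟩
    change map j (aeval s₀ (w₀ i)) = _
    rw [hcomm, hw₀, h, map_X]
  have hinj := RingHom.injective_of_surjective_of_isNoetherianRing
    (aeval (R := C₀) s₀).toRingHom hsurj
  have : p₀ = 0 := by
    apply hinj
    apply map_injective j hj
    change map j (aeval s₀ p₀) = map j (aeval s₀ 0)
    rw [hcomm, hp₀, hp, map_zero, map_zero]
  rw [← hp₀, this, map_zero]

/-- If a polynomial substitution in finitely many variables is surjective, it is invertible. -/
theorem exists_inverse_substitution {σ C : Type*} [Finite σ] [CommRing C]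
    (s : σ → MvPolynomial σ C) (h : Function.Surjective (aeval (R := C) s)) :
    ∃ w : σ → MvPolynomial σ C, (∀ i, aeval s (w i) = X i) ∧ ∀ i, aeval w (s i) = X i := by
  choose w hw using fun i ↦ h (X i)
  refine ⟨w, hw, fun i ↦ aeval_injective_of_aeval_eq_X s w hw ?_⟩
  have : (aeval (R := C) s).comp (aeval w) = AlgHom.id C _ := by
    refine algHom_ext fun j ↦ ?_
    rw [AlgHom.comp_apply, aeval_X, hw, AlgHom.id_apply]
  rw [← AlgHom.comp_apply, this]
  simp

/-- Polynomials which generate the polynomial ring modulo nilpotent elements generate it. -/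
theorem subalgebra_eq_top_of_sub_isNilpotent {σ C : Type*} [Finite σ] [CommRing C]
    (D : Subalgebra C (MvPolynomial σ C))
    (h : ∀ i, ∃ d ∈ D, IsNilpotent (X i - d)) : D = ⊤ := by
  cases nonempty_fintype σ
  classical
  choose d hd hnil using h
  -- These coefficients are nilpotent and finite in number, so the ideal they generate is nilpotent.
  let T : Finset C := Finset.univ.biUnion fun i ↦ (X i - d i).coeffs
  let I : Ideal C := Ideal.span (T : Set C)
  have hI : IsNilpotent I := by
    rw [Ideal.FG.isNilpotent_iff_le_nilradical ⟨T, rfl⟩, Ideal.span_le]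
    intro c hc
    simp only [T, Finset.coe_biUnion, Set.mem_iUnion] at hc
    obtain ⟨i, -, hc⟩ := hc
    obtain ⟨m, -, rfl⟩ := mem_coeffs_iff.mp hc
    exact isNilpotent_iff.mp (hnil i) m
  have hX : ∀ i, X i - d i ∈ I.map (MvPolynomial.C (σ := σ) (R := C)) := by
    intro i
    rw [mem_map_C_iff]
    intro m
    by_cases hm : coeff m (X i - d i) = 0
    · rw [hm]; exact I.zero_mem
    · refine Ideal.subset_span ?_
      simp only [T, Finset.coe_biUnion, Set.mem_iUnion]
      exact ⟨i, by simp, coeff_mem_coeffs m hm⟩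
  let J := I.map (MvPolynomial.C (σ := σ) (R := C))
  have hmap : D.map (Ideal.Quotient.mkₐ C J) = ⊤ := by
    have hsurj := Ideal.Quotient.mkₐ_surjective C J
    rw [← (AlgHom.range_eq_top _).mpr hsurj, ← Algebra.map_top]
    refine le_antisymm (Subalgebra.map_mono le_top) ?_
    rw [← adjoin_range_X, AlgHom.map_adjoin, Algebra.adjoin_le_iff]
    rintro _ ⟨_, ⟨i, rfl⟩, rfl⟩
    exact ⟨d i, hd i, (Ideal.Quotient.eq.mpr (hX i)).symm⟩
  have hstep : (⊤ : Submodule C (MvPolynomial σ C)) ≤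
      D.toSubmodule ⊔ I • (⊤ : Submodule C (MvPolynomial σ C)) := by
    intro p _
    have : Ideal.Quotient.mkₐ C J p ∈ D.map (Ideal.Quotient.mkₐ C J) := hmap ▸ Algebra.mem_top
    obtain ⟨q, hq, hqp⟩ := this
    have hmem : p - q ∈ I • (⊤ : Submodule C (MvPolynomial σ C)) := by
      rw [Ideal.smul_top_eq_map]
      exact Ideal.Quotient.eq.mp hqp.symm
    rw [← add_sub_cancel q p]
    exact Submodule.add_mem_sup hq hmem
  -- Substituting `hstep` into the right-hand side raises the exponent of `I` by one, because `D`
  -- absorbs multiples by `I ^ m`.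
  have hpow : ∀ m : ℕ, (⊤ : Submodule C (MvPolynomial σ C)) ≤
      D.toSubmodule ⊔ I ^ m • (⊤ : Submodule C (MvPolynomial σ C)) := by
    intro m
    induction m with
    | zero => rw [pow_zero, one_smul]; exact le_sup_right
    | succ m ih =>
      calc ⊤ ≤ D.toSubmodule ⊔ I ^ m • (⊤ : Submodule C (MvPolynomial σ C)) := ih
        _ ≤ D.toSubmodule ⊔ I ^ m • (D.toSubmodule ⊔ I • ⊤) := by gcongr
        _ ≤ _ := by
          rw [Submodule.smul_sup, ← mul_smul, ← pow_succ, ← sup_assoc]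
          gcongr
          exact sup_le le_rfl Submodule.smul_le_right
  obtain ⟨m, hm⟩ := hI
  have := hpow m
  rw [hm, Submodule.zero_eq_bot, Submodule.bot_smul, sup_bot_eq] at this
  exact eq_top_iff.mpr fun p _ ↦ this Submodule.mem_top

end MvPolynomial

/-! ### Polynomial extensions: generators, evaluation at central elements, constant coefficients. -/

namespace PolyExt

section Basic

variable {k : Type v} [Field k] {n : ℕ} {A : Type u} [Ring A] [Algebra k A]

/-- The inclusion of the constant polynomials. -/
noncomputable def constHom (k : Type v) [Field k] (n : ℕ) (A : Type u) [Ring A] [Algebra k A] :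
    A →ₐ[k] PolyExt n A :=
  AddMonoidAlgebra.singleZeroAlgHom

theorem constHom_apply (a : A) : constHom k n A a = AddMonoidAlgebra.single 0 a := rfl

theorem commute_constHom_var (a : A) (i : Fin n) : Commute (constHom k n A a) (var n A i) := by
  simp [Commute, SemiconjBy, constHom_apply, var, AddMonoidAlgebra.single_mul_single]

theorem var_mul_var (i j : Fin n) : Commute (var n A i) (var n A j) := by
  simp [Commute, SemiconjBy, var, AddMonoidAlgebra.single_mul_single, add_comm]

theorem single_mem_of_const_of_var (D : Subring (PolyExt n A))
    (hc : ∀ a, constHom k n A a ∈ D) (hv : ∀ i, var n A i ∈ D) (m : Fin n →₀ ℕ) (a : A) :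
    AddMonoidAlgebra.single m a ∈ D := by
  have h1 : ∀ m : Fin n →₀ ℕ, (AddMonoidAlgebra.single m 1 : PolyExt n A) ∈ D := by
    intro m
    induction m using Finsupp.induction_linear with
    | zero => exact D.one_mem
    | add f g hf hg =>
      have := D.mul_mem hf hg
      rwa [AddMonoidAlgebra.single_mul_single, one_mul] at this
    | single i e =>
      have := D.pow_mem (hv i) e
      rw [var, AddMonoidAlgebra.single_pow, one_pow] at this
      simpa using this
  have := D.mul_mem (hc a) (h1 m)
  rwa [constHom_apply, AddMonoidAlgebra.single_mul_single, mul_one, zero_add] at this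

theorem subring_eq_top (D : Subring (PolyExt n A))
    (hc : ∀ a, constHom k n A a ∈ D) (hv : ∀ i, var n A i ∈ D) : D = ⊤ := by
  refine eq_top_iff.mpr fun p _ ↦ ?_
  induction p using AddMonoidAlgebra.induction_linear with
  | zero => exact D.zero_mem
  | add f g hf hg => exact D.add_mem (hf trivial) (hg trivial)
  | single m a => exact single_mem_of_const_of_var D hc hv m a

theorem subalgebra_eq_top (D : Subalgebra k (PolyExt n A))
    (hc : ∀ a, constHom k n A a ∈ D) (hv : ∀ i, var n A i ∈ D) : D = ⊤ := by
  have := subring_eq_top (k := k) D.toSubring hc hv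
  exact eq_top_iff.mpr fun p _ ↦ (this ▸ Subring.mem_top p : p ∈ D.toSubring)

theorem adjoin_const_union_range_var :
    Algebra.adjoin k ((const k n A : Set (PolyExt n A)) ∪ Set.range (var n A)) = ⊤ :=
  subalgebra_eq_top _ (fun a ↦ Algebra.subset_adjoin (.inl ⟨a, rfl⟩))
    fun i ↦ Algebra.subset_adjoin (.inr ⟨i, rfl⟩)

theorem var_mem_center (i : Fin n) : var n A i ∈ Subalgebra.center k (PolyExt n A) := by
  rw [Subalgebra.mem_center_iff]
  have := subring_eq_top (k := k) (Subring.centralizer {var n A i})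
    (fun a ↦ by
      rw [Subring.mem_centralizer_iff]
      rintro _ rfl
      exact (commute_constHom_var a i).eq.symm)
    (fun j ↦ by
      rw [Subring.mem_centralizer_iff]
      rintro _ rfl
      exact (var_mul_var i j).eq)
  intro p
  have hp : p ∈ Subring.centralizer {var n A i} := this ▸ Subring.mem_top p
  exact (Subring.mem_centralizer_iff.mp hp _ rfl).symm

variable {R : Type w} [Ring R] [Algebra k R]

theorem hom_ext {f g : PolyExt n A →ₐ[k] R}
    (hc : ∀ a, f (constHom k n A a) = g (constHom k n A a))
    (hv : ∀ i, f (var n A i) = g (var n A i)) : f = g := by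
  have := subalgebra_eq_top (AlgHom.equalizer f g) hc hv
  refine DFunLike.ext _ _ fun p ↦ ?_
  exact (this ▸ Algebra.mem_top : p ∈ AlgHom.equalizer f g)

/-- The monomials in a family of central elements. -/
noncomputable def centralMonomial (s : Fin n → Subalgebra.center k R) :
    Multiplicative (Fin n →₀ ℕ) →* Subalgebra.center k R where
  toFun m := ∏ i, s i ^ (Multiplicative.toAdd m i)
  map_one' := by simp
  map_mul' x y := by
    rw [← Finset.prod_mul_distrib]
    simp only [toAdd_mul, Finsupp.add_apply, pow_add]

/-- Evaluation of polynomials at central elements of an algebra. -/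
noncomputable def eval (f : A →ₐ[k] R) (s : Fin n → Subalgebra.center k R) : PolyExt n A →ₐ[k] R :=
  AddMonoidAlgebra.liftNCAlgHom f
    (((Subalgebra.center k R).val : _ →* R).comp (centralMonomial s))
    fun x y ↦ Subalgebra.mem_center_iff.mp (centralMonomial s y).2 (f x)

theorem eval_single (f : A →ₐ[k] R) (s : Fin n → Subalgebra.center k R) (m : Fin n →₀ ℕ) (a : A) :
    eval f s (AddMonoidAlgebra.single m a) =
      f a * (centralMonomial s (Multiplicative.ofAdd m) : R) :=
  AddMonoidAlgebra.liftNC_single _ _ _ _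

@[simp]
theorem eval_constHom (f : A →ₐ[k] R) (s : Fin n → Subalgebra.center k R) (a : A) :
    eval f s (constHom k n A a) = f a := by
  rw [constHom_apply, eval_single, ofAdd_zero, map_one, OneMemClass.coe_one, mul_one]

@[simp]
theorem eval_var (f : A →ₐ[k] R) (s : Fin n → Subalgebra.center k R) (i : Fin n) :
    eval f s (var n A i) = s i := by
  rw [var, eval_single, map_one, one_mul]
  congr 1
  change ∏ j, s j ^ (Finsupp.single i 1 j) = s i
  rw [Finset.prod_eq_single i] <;> simp +contextual [eq_comm]

/-- The constant coefficient. -/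
noncomputable def constCoeff (k : Type v) [Field k] (n : ℕ) (A : Type u) [Ring A] [Algebra k A] :
    PolyExt n A →ₐ[k] A :=
  eval (AlgHom.id k A) 0

@[simp]
theorem constCoeff_constHom (a : A) : constCoeff k n A (constHom k n A a) = a := by
  simp [constCoeff]

@[simp]
theorem constCoeff_var (i : Fin n) : constCoeff k n A (var n A i) = 0 := by
  simp [constCoeff]

/-- Modulo the variables, the identity and the constant-coefficient projection agree on constants
and on variables, hence everywhere. -/
theorem sub_constHom_constCoeff_mem (p : PolyExt n A) :
    p - constHom k n A (constCoeff k n A p) ∈ Ideal.span (Set.range (var n A)) := by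
  let I := Ideal.span (Set.range (var n A))
  -- `Ideal.span` is only a left ideal; centrality of the variables makes it two-sided.
  have hI : I.IsTwoSided := by
    refine ⟨fun {a} b ha ↦ ?_⟩
    induction ha using Submodule.span_induction with
    | zero => simp
    | add x y _ _ hx hy => rw [add_mul]; exact I.add_mem hx hy
    | smul r x _ hx => rw [smul_eq_mul, mul_assoc]; exact I.mul_mem_left r hx
    | mem x hx =>
      obtain ⟨i, rfl⟩ := hx
      rw [← Subalgebra.mem_center_iff.mp (var_mem_center (k := k) i) b]
      exact I.mul_mem_left b (Ideal.subset_span ⟨i, rfl⟩)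
  have h : (Ideal.Quotient.mkₐ k I).comp ((constHom k n A).comp (constCoeff k n A)) =
      Ideal.Quotient.mkₐ k I := by
    refine hom_ext (fun a ↦ by simp) fun i ↦ ?_
    simp only [AlgHom.comp_apply, constCoeff_var, map_zero]
    exact (Ideal.Quotient.eq_zero_iff_mem.mpr (Ideal.subset_span (Set.mem_range_self i))).symm
  exact Ideal.Quotient.eq.mp (DFunLike.congr_fun h p).symm

variable {B : Type w} [Ring B] [Algebra k B]

/-- Passing to constant coefficients commutes with composing such maps; this makes the two induced
maps between `A` and `B` mutually inverse. -/
theorem constCoeff_map_constHom_constCoeff (f : PolyExt n A →ₐ[k] PolyExt n B)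
    (hf : ∀ i, f (var n A i) = var n B i) (p : PolyExt n A) :
    constCoeff k n B (f (constHom k n A (constCoeff k n A p))) = constCoeff k n B (f p) := by
  have : ((constCoeff k n B).comp f).comp ((constHom k n A).comp (constCoeff k n A)) =
      (constCoeff k n B).comp f := hom_ext (fun a ↦ by simp) fun i ↦ by simp [hf]
  exact DFunLike.congr_fun this p

/-- An algebra isomorphism of polynomial extensions that matches the variables induces an
isomorphism of the base algebras. -/
theorem nonempty_algEquiv_of_map_var (χ : PolyExt n A ≃ₐ[k] PolyExt n B)
    (h : ∀ i, χ (var n A i) = var n B i) : Nonempty (A ≃ₐ[k] B) := by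
  have h' : ∀ i, χ.symm (var n B i) = var n A i := fun i ↦ by rw [← h, χ.symm_apply_apply]
  refine ⟨AlgEquiv.ofAlgHom
    ((constCoeff k n B).comp ((χ : PolyExt n A →ₐ[k] PolyExt n B).comp (constHom k n A)))
    ((constCoeff k n A).comp ((χ.symm : PolyExt n B →ₐ[k] PolyExt n A).comp (constHom k n B)))
    (AlgHom.ext fun b ↦ ?_) (AlgHom.ext fun a ↦ ?_)⟩
  · simpa using constCoeff_map_constHom_constCoeff (χ : PolyExt n A →ₐ[k] PolyExt n B) h
      (χ.symm (constHom k n B b))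
  · simpa using constCoeff_map_constHom_constCoeff (χ.symm : PolyExt n B →ₐ[k] PolyExt n A) h'
      (χ (constHom k n A a))

end Basic

/-! ### Change of coefficients and the center of a polynomial extension. -/

section Map

variable {k : Type v} [Field k] {n : ℕ} {A : Type u} [Ring A] [Algebra k A]
  {B : Type w} [Ring B] [Algebra k B]

/-- The map of polynomial extensions induced by a map of coefficients. -/
noncomputable abbrev map (n : ℕ) (f : A →ₐ[k] B) : PolyExt n A →ₐ[k] PolyExt n B :=
  AddMonoidAlgebra.mapAlgHom (Fin n →₀ ℕ) f

theorem map_constHom (f : A →ₐ[k] B) (a : A) :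
    map n f (constHom k n A a) = constHom k n B (f a) := by
  simp [constHom_apply]

theorem map_var (f : A →ₐ[k] B) (i : Fin n) : map n f (var n A i) = var n B i := by
  simp [var]

theorem map_injective {f : A →ₐ[k] B} (hf : Function.Injective f) :
    Function.Injective (map n f) :=
  AddMonoidAlgebra.map_injective (f : A →+ B) hf

theorem map_surjective {f : A →ₐ[k] B} (hf : Function.Surjective f) :
    Function.Surjective (map n f) :=
  AddMonoidAlgebra.map_surjective (f : A →+ B) hf

theorem map_mem_center (f : A →ₐ[k] B) (hf : ∀ a, f a ∈ Subalgebra.center k B) (z : PolyExt n A) :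
    map n f z ∈ Subalgebra.center k (PolyExt n B) := by
  have : (Subalgebra.center k (PolyExt n B)).comap (map n f) = ⊤ := by
    refine subalgebra_eq_top _ (fun a ↦ ?_) fun i ↦ ?_
    · rw [Subalgebra.mem_comap, map_constHom, Subalgebra.mem_center_iff]
      have := subring_eq_top (k := k) (Subring.centralizer {constHom k n B (f a)})
        (fun b ↦ by
          rw [Subring.mem_centralizer_iff]
          rintro _ rfl
          rw [← map_mul, ← map_mul, Subalgebra.mem_center_iff.mp (hf a) b])
        (fun j ↦ by
          rw [Subring.mem_centralizer_iff]
          rintro _ rfl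
          exact (commute_constHom_var _ j).eq)
      intro p
      have hp : p ∈ Subring.centralizer {constHom k n B (f a)} := this ▸ Subring.mem_top p
      exact (Subring.mem_centralizer_iff.mp hp _ rfl).symm
    · rw [Subalgebra.mem_comap, map_var]
      exact var_mem_center i
  exact (this ▸ Algebra.mem_top : z ∈ (Subalgebra.center k (PolyExt n B)).comap (map n f))

theorem coeff_mem_center {p : PolyExt n A} (hp : p ∈ Subalgebra.center k (PolyExt n A))
    (m : Fin n →₀ ℕ) : p.coeff m ∈ Subalgebra.center k A := by
  rw [Subalgebra.mem_center_iff] at hp ⊢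
  intro a
  have := congrArg (fun q ↦ q.coeff m) (hp (constHom k n A a))
  simpa only [constHom_apply, AddMonoidAlgebra.coeff_single_zero_mul,
    AddMonoidAlgebra.coeff_mul_single_zero] using this

/-- The center of `A[t₁, …, tₙ]` is `Z[t₁, …, tₙ]`, where `Z` is the center of `A`. -/
noncomputable def centerEquiv (k : Type v) [Field k] (n : ℕ) (A : Type u) [Ring A] [Algebra k A] :
    PolyExt n (Subalgebra.center k A) ≃ₐ[k] Subalgebra.center k (PolyExt n A) :=
  AlgEquiv.ofBijective
    ((map n (Subalgebra.center k A).val).codRestrict _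
      (map_mem_center _ Subtype.prop))
    ⟨fun _ _ h ↦ map_injective Subtype.val_injective (congrArg Subtype.val h), fun z ↦ by
      have : z.1 ∈ Set.range (map n (Subalgebra.center k A).val) := by
        change _ ∈ Set.range (AddMonoidAlgebra.map
          ((Subalgebra.center k A).val : Subalgebra.center k A →+ A))
        rw [AddMonoidAlgebra.range_map]
        exact fun m ↦ ⟨⟨_, coeff_mem_center z.2 m⟩, rfl⟩
      obtain ⟨q, hq⟩ := this
      exact ⟨q, Subtype.ext hq⟩⟩

theorem coe_centerEquiv (z : PolyExt n (Subalgebra.center k A)) :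
    (centerEquiv k n A z : PolyExt n A) = map n (Subalgebra.center k A).val z := rfl

end Map

end PolyExt

/-! ### The center of a ring as the natural endomorphisms of the identity functor. -/

namespace ModuleCat

section CenterAction

variable {k : Type v} [Field k] {R : Type u} [Ring R] [Algebra k R]

/-- The action of a central element on a module, as an endomorphism. -/
def centerAction (z : Subalgebra.center k R) (M : ModuleCat.{u} R) : M ⟶ M :=
  ModuleCat.ofHom
    { toFun := fun m ↦ (z : R) • m
      map_add' := smul_add _
      map_smul' := fun r m ↦ by
        rw [RingHom.id_apply, ← mul_smul, ← mul_smul, Subalgebra.mem_center_iff.mp z.2] }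

theorem centerAction_naturality (z : Subalgebra.center k R) {M N : ModuleCat.{u} R} (f : M ⟶ N) :
    centerAction z M ≫ f = f ≫ centerAction z N := by
  ext m; exact f.hom.map_smul (z : R) m

theorem centerAction_injective {z w : Subalgebra.center k R}
    (h : centerAction z (ModuleCat.of R R) = centerAction w (ModuleCat.of R R)) : z = w := by
  have := congrArg (fun f ↦ f.hom (1 : R)) h
  exact Subtype.ext (((mul_one _).symm.trans this).trans (mul_one _))

/-- Every natural endomorphism of the identity functor is the action of a central element. -/
theorem exists_centerAction_eq (η : ∀ M : ModuleCat.{u} R, M ⟶ M)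
    (hη : ∀ {M N : ModuleCat.{u} R} (f : M ⟶ N), η M ≫ f = f ≫ η N) :
    ∃ z : Subalgebra.center k R, ∀ M, η M = centerAction z M := by
  let R' : ModuleCat.{u} R := ModuleCat.of R R
  let c : R := (η R').hom (1 : R)
  -- Naturality along the map `R → M`, `1 ↦ m`, shows that `η` is determined by its value at `1`.
  have key : ∀ (M : ModuleCat.{u} R) (m : M), (η M).hom m = c • m := by
    intro M m
    have h := hη (M := R') (N := M) (ModuleCat.ofHom (LinearMap.toSpanSingleton R M m))
    have := congrArg (fun f ↦ f.hom (1 : R)) h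
    refine Eq.trans ?_ this.symm
    change (η M).hom m = (η M).hom ((1 : R) • m)
    rw [one_smul]
  have hc : c ∈ Subalgebra.center k R := by
    rw [Subalgebra.mem_center_iff]
    intro r
    have h1 : (η R').hom (r • (1 : R)) = r • c := (η R').hom.map_smul r (1 : R)
    rw [key R' (r • (1 : R))] at h1
    simpa using h1.symm
  exact ⟨⟨c, hc⟩, fun M ↦ by ext m; exact key M m⟩

end CenterAction

section CenterEquiv

open scoped ModuleCat.Algebra

variable {k : Type v} [Field k] {R S : Type u} [Ring R] [Algebra k R] [Ring S] [Algebra k S]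

theorem centerAction_algebraMap (c : k) (M : ModuleCat.{u} R) :
    centerAction (algebraMap k (Subalgebra.center k R) c) M = c • 𝟙 M := by
  ext m; rfl

theorem centerAction_mul (z w : Subalgebra.center k R) (M : ModuleCat.{u} R) :
    centerAction (z * w) M = centerAction w M ≫ centerAction z M := by
  ext m; exact mul_smul (z : R) (w : R) m

theorem centerAction_add (z w : Subalgebra.center k R) (M : ModuleCat.{u} R) :
    centerAction (z + w) M = centerAction z M + centerAction w M := by
  ext m; exact add_smul (z : R) (w : R) m

/-- A linear equivalence of module categories identifies the centers of the rings, compatibly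
with the action of the centers on modules. -/
theorem exists_center_algEquiv (e : ModuleCat.{u} R ≌ ModuleCat.{u} S) [e.functor.Additive]
    [e.functor.Linear k] :
    ∃ ω : Subalgebra.center k R ≃ₐ[k] Subalgebra.center k S,
      ∀ z M, e.functor.map (centerAction z M) = centerAction (ω z) (e.functor.obj M) := by
  have hex : ∀ z : Subalgebra.center k R, ∃ w : Subalgebra.center k S,
      ∀ M, e.functor.map (centerAction z M) = centerAction w (e.functor.obj M) := by
    intro z
    -- The action of `z` is conjugated by the counit to a natural endomorphism of the identity
    -- functor over `S`.
    obtain ⟨w, hw⟩ := exists_centerAction_eq (k := k) (R := S)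
      (fun N ↦ e.counitInv.app N ≫ e.functor.map (centerAction z (e.inverse.obj N)) ≫
        e.counit.app N) (by
        intro M N f
        have h1 : e.functor.map (centerAction z (e.inverse.obj M)) ≫
            e.functor.map (e.inverse.map f) = e.functor.map (e.inverse.map f) ≫
              e.functor.map (centerAction z (e.inverse.obj N)) := by
          rw [← Functor.map_comp, ← Functor.map_comp, centerAction_naturality]
        have h2 := e.counit.naturality f
        have h3 := e.counitInv.naturality f
        dsimp at h2 h3
        rw [Category.assoc, Category.assoc, ← h2, reassoc_of% h1, reassoc_of% h3])
    refine ⟨w, fun M ↦ ?_⟩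
    rw [← hw, ← cancel_epi (e.counit.app (e.functor.obj M))]
    have h4 : centerAction z (e.inverse.obj (e.functor.obj M)) ≫ e.unitInv.app M =
        e.unitInv.app M ≫ centerAction z M := centerAction_naturality z (e.unitInv.app M)
    have h5 : e.counit.app (e.functor.obj M) = e.functor.map (e.unitInv.app M) :=
      e.counit_app_functor M
    have h6 : e.counit.app (e.functor.obj M) ≫ e.counitInv.app (e.functor.obj M) = 𝟙 _ := by
      simp
    rw [reassoc_of% h6, h5, ← Functor.map_comp, ← Functor.map_comp]
    exact congrArg e.functor.map h4.symm
  -- `S` is isomorphic to an object in the image of `e.functor`, and the action on `S` determines a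
  -- central element. The algebra laws for `ω` and its surjectivity follow from this uniqueness.
  have huniq : ∀ w w' : Subalgebra.center k S,
      (∀ M, centerAction w (e.functor.obj M) = centerAction w' (e.functor.obj M)) → w = w' := by
    intro w w' h
    apply centerAction_injective
    let i : e.functor.obj (e.inverse.obj (ModuleCat.of S S)) ≅ ModuleCat.of S S :=
      e.counitIso.app (ModuleCat.of S S)
    rw [← cancel_epi i.hom, ← centerAction_naturality, ← centerAction_naturality]
    exact congrArg (· ≫ i.hom) (h _)
  choose ω hω using hex
  let ω' : Subalgebra.center k R →ₐ[k] Subalgebra.center k S :=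
    { toFun := ω
      map_one' := huniq _ _ fun M ↦ by
        rw [← hω]
        have : centerAction (1 : Subalgebra.center k R) M = 𝟙 M := by ext m; exact one_smul R m
        rw [this, CategoryTheory.Functor.map_id]
        ext m; exact (one_smul S m).symm
      map_mul' := fun z w ↦ huniq _ _ fun M ↦ by
        rw [← hω, centerAction_mul, Functor.map_comp, hω, hω, centerAction_mul]
      map_zero' := huniq _ _ fun M ↦ by
        rw [← hω]
        have : centerAction (0 : Subalgebra.center k R) M = 0 := by ext m; exact zero_smul R m
        rw [this, Functor.map_zero]
        ext m; exact (zero_smul S m).symm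
      map_add' := fun z w ↦ huniq _ _ fun M ↦ by
        rw [← hω, centerAction_add, Functor.map_add, hω, hω, centerAction_add]
      commutes' := fun c ↦ huniq _ _ fun M ↦ by
        rw [← hω, centerAction_algebraMap, centerAction_algebraMap, Functor.map_smul,
          CategoryTheory.Functor.map_id] }
  refine ⟨AlgEquiv.ofBijective ω' ⟨fun z w h ↦ ?_, fun w ↦ ?_⟩, hω⟩
  · apply centerAction_injective
    apply e.functor.map_injective
    rw [hω, hω]
    exact congrArg (centerAction · _) h
  · obtain ⟨z, hz⟩ := exists_centerAction_eq (k := k) (R := R)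
      (fun M ↦ e.functor.preimage (centerAction w (e.functor.obj M))) (by
        intro M N f
        apply e.functor.map_injective
        rw [Functor.map_comp, Functor.map_comp, Functor.map_preimage, Functor.map_preimage,
          centerAction_naturality])
    refine ⟨z, huniq _ _ fun M ↦ ?_⟩
    change centerAction (ω z) _ = _
    rw [← hω, ← hz, Functor.map_preimage]

end CenterEquiv

/-! ### Modules over a retract, and descent of Morita equivalences. -/

section Retract

variable {k : Type v} [Field k] {R R' : Type u} [Ring R] [Algebra k R] [Ring R'] [Algebra k R']

open scoped ModuleCat.Algebra

/-- The modules over `R` on which `R` acts through the idempotent endomorphism `g ∘ f`. -/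
def actsThrough (f : R →ₐ[k] R') (g : R' →ₐ[k] R) : ObjectProperty (ModuleCat.{u} R) :=
  fun M ↦ ∀ (r : R) (m : M), r • m = g (f r) • m

instance (f : R →ₐ[k] R') (g : R' →ₐ[k] R) : (actsThrough f g).IsClosedUnderIsomorphisms where
  of_iso {M N} i hM r m := by
    have h := congrArg i.hom.hom (hM r (i.inv.hom m))
    rw [map_smul, map_smul] at h
    have h' : i.hom.hom (i.inv.hom m) = m := by
      rw [← ModuleCat.comp_apply, i.inv_hom_id, ModuleCat.id_apply]
    rwa [h'] at h

variable (f : R →ₐ[k] R') (g : R' →ₐ[k] R)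

theorem actsThrough_restrictScalars (hfg : ∀ x, f (g x) = x) (N : ModuleCat.{u} R') :
    actsThrough f g ((ModuleCat.restrictScalars f.toRingHom).obj N) := by
  intro r m
  rw [ModuleCat.restrictScalars.smul_def, ModuleCat.restrictScalars.smul_def]
  exact congrArg (fun x ↦ x • _) (hfg (f r)).symm

/-- Restriction of scalars along a retraction, as a functor to the modules on which the ring
acts through the retraction. -/
noncomputable def restrictScalarsLift (hfg : ∀ x, f (g x) = x) :
    ModuleCat.{u} R' ⥤ (actsThrough f g).FullSubcategory :=
  (actsThrough f g).lift (ModuleCat.restrictScalars f.toRingHom)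
    (actsThrough_restrictScalars f g hfg)

/-- `f` is surjective, so restriction along it is fully faithful. Restricting `M` along `g` and then
along `f` gives back `M`, exactly because `R` acts on it through `g ∘ f`. -/
theorem restrictScalarsLift_isEquivalence (hfg : ∀ x, f (g x) = x) :
    (restrictScalarsLift f g hfg).IsEquivalence := by
  have hfull : (ModuleCat.restrictScalars.{u} f.toRingHom).Full :=
    { map_surjective := fun {M N} φ ↦ by
        refine ⟨ModuleCat.ofHom
          { toFun := fun m ↦ φ.hom m
            map_add' := fun a b ↦ φ.hom.map_add a b
            map_smul' := fun r m ↦ ?_ }, ?_⟩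
        · have h : φ.hom (f (g r) • m) = f (g r) • φ.hom m := φ.hom.map_smul (g r) m
          rwa [hfg] at h
        · ext m; rfl }
  have : (restrictScalarsLift f g hfg).Full := by unfold restrictScalarsLift; infer_instance
  have : (restrictScalarsLift f g hfg).Faithful := by unfold restrictScalarsLift; infer_instance
  have : (restrictScalarsLift f g hfg).EssSurj :=
    { mem_essImage := fun M ↦ by
        refine ⟨(ModuleCat.restrictScalars g.toRingHom).obj M.obj, ⟨?_⟩⟩
        let N := (ModuleCat.restrictScalars f.toRingHom).obj
          ((ModuleCat.restrictScalars g.toRingHom).obj M.obj)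
        let l : N ≃ₗ[R] M.obj :=
          { toFun := fun m ↦ m
            invFun := fun m ↦ m
            map_add' := fun _ _ ↦ rfl
            map_smul' := fun r m ↦ (M.property r m).symm
            left_inv := fun _ ↦ rfl
            right_inv := fun _ ↦ rfl }
        exact (actsThrough f g).isoMk (LinearEquiv.toModuleIso l) }
  exact {}

end Retract

end ModuleCat

section MoritaDescent

open scoped ModuleCat.Algebra

variable {k : Type v} [Field k]

/-- A Morita equivalence that matches the modules on which two retractions act descends to a
Morita equivalence between the retracts. -/
theorem MoritaEquivalence.isMoritaEquivalent_retract {R R' S S' : Type u}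
    [Ring R] [Algebra k R] [Ring R'] [Algebra k R'] [Ring S] [Algebra k S] [Ring S'] [Algebra k S']
    (e : MoritaEquivalence k R S) (f : R →ₐ[k] R') (g : R' →ₐ[k] R) (hfg : ∀ x, f (g x) = x)
    (f' : S →ₐ[k] S') (g' : S' →ₐ[k] S) (hfg' : ∀ x, f' (g' x) = x)
    (h : (ModuleCat.actsThrough f' g').inverseImage e.eqv.functor = ModuleCat.actsThrough f g) :
    IsMoritaEquivalent k R' S' := by
  have := ModuleCat.restrictScalarsLift_isEquivalence f g hfg
  have := ModuleCat.restrictScalarsLift_isEquivalence f' g' hfg'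
  let E₁ := (ModuleCat.restrictScalarsLift f g hfg).asEquivalence
  let E₂ := e.eqv.congrFullSubcategory h
  let E₃ := (ModuleCat.restrictScalarsLift f' g' hfg').asEquivalence
  have l₁ : E₁.functor.Linear k :=
    { map_smul := fun a c ↦ by
        apply ObjectProperty.hom_ext
        exact (ModuleCat.restrictScalars f.toRingHom).map_smul c a }
  have a₃ : E₃.functor.Additive :=
    { map_add := fun {_ _ a b} ↦ by
        apply ObjectProperty.hom_ext
        exact (ModuleCat.restrictScalars f'.toRingHom).map_add }
  have l₃ : E₃.functor.Linear k :=
    { map_smul := fun a c ↦ by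
        apply ObjectProperty.hom_ext
        exact (ModuleCat.restrictScalars f'.toRingHom).map_smul c a }
  have l₂ : E₂.functor.Linear k :=
    { map_smul := fun a c ↦ by
        apply ObjectProperty.hom_ext
        exact e.eqv.functor.map_smul c a.hom }
  have l₃' : E₃.symm.functor.Linear k := E₃.inverseLinear k
  exact ⟨⟨{ eqv := (E₁.trans E₂).trans E₃.symm
            linear := inferInstanceAs
              (((E₁.functor ⋙ E₂.functor) ⋙ E₃.symm.functor).Linear k) }⟩⟩

end MoritaDescent

/-! ### Transport of centers and of quotients. -/

/-- The center of the opposite algebra. -/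
def Subalgebra.centerOpEquiv (k : Type v) [Field k] (R : Type u) [Ring R] [Algebra k R] :
    Subalgebra.center k R ≃ₐ[k] Subalgebra.center k Rᵐᵒᵖ where
  toFun z := ⟨MulOpposite.op z.1, Subalgebra.mem_center_iff.mpr fun b ↦
    MulOpposite.unop_injective (Subalgebra.mem_center_iff.mp z.2 b.unop).symm⟩
  invFun z := ⟨z.1.unop, Subalgebra.mem_center_iff.mpr fun b ↦
    MulOpposite.op_injective (Subalgebra.mem_center_iff.mp z.2 (MulOpposite.op b)).symm⟩
  left_inv _ := rfl
  right_inv _ := rfl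
  map_mul' z w := Subtype.ext (congrArg MulOpposite.op (Subalgebra.mem_center_iff.mp w.2 z.1))
  map_add' _ _ := rfl
  commutes' _ := rfl

theorem AlgEquiv.exists_map_of_surjective {k : Type*} [CommRing k] {R R' S S' : Type*}
    [CommRing R] [Algebra k R] [CommRing R'] [Algebra k R'] [CommRing S] [Algebra k S]
    [CommRing S'] [Algebra k S'] (φ : R ≃ₐ[k] S) (π : R →ₐ[k] R') (ρ : S →ₐ[k] S')
    (hπ : Function.Surjective π) (hρ : Function.Surjective ρ)
    (h : ∀ x, π x = 0 ↔ ρ (φ x) = 0) :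
    ∃ φ' : R' ≃ₐ[k] S', ∀ x, φ' (π x) = ρ (φ x) := by
  let ρ' : R →ₐ[k] S' := ρ.comp φ
  have hρ' : Function.Surjective ρ' := hρ.comp φ.surjective
  have hker : RingHom.ker π = RingHom.ker ρ' := by
    ext x; exact h x
  refine ⟨(Ideal.quotientKerAlgEquivOfSurjective hπ).symm.trans
    ((Ideal.quotientEquivAlgOfEq k hker).trans (Ideal.quotientKerAlgEquivOfSurjective hρ')),
    fun x ↦ ?_⟩
  have : (Ideal.quotientKerAlgEquivOfSurjective hπ).symm (π x) =
      Ideal.Quotient.mk (RingHom.ker π) x := by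
    rw [AlgEquiv.symm_apply_eq]; rfl
  rw [AlgEquiv.trans_apply, this]
  rfl

/-- The isomorphism of centers induced by an isomorphism of algebras. -/
def Subalgebra.centerAlgEquivCongr {k : Type v} [Field k] {R : Type u} {S : Type w} [Ring R]
    [Algebra k R] [Ring S] [Algebra k S] (φ : R ≃ₐ[k] S) :
    Subalgebra.center k R ≃ₐ[k] Subalgebra.center k S :=
  AlgEquiv.ofRingEquiv (f := Subring.centerCongr φ.toRingEquiv) fun c ↦
    Subtype.ext (φ.commutes c)

/-! ### Automorphisms of B[t] obtained from generators over a central ring. -/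

namespace PolyExt

variable {k : Type v} [Field k] {n : ℕ}

/-- Each polynomial differs from its constant term by an element of the ideal of the variables, so
only the action of the `ψ(tᵢ)` matters. These are central, so a Morita equivalence can detect the
condition. -/
theorem actsThrough_op_iff {B : Type u} [Ring B] [Algebra k B] (ψ : PolyExt n B ≃ₐ[k] PolyExt n B)
    (M : ModuleCat.{u} (PolyExt n B)ᵐᵒᵖ) :
    ModuleCat.actsThrough
        (AlgHom.op ((constCoeff k n B).comp (ψ.symm : PolyExt n B →ₐ[k] PolyExt n B)))
        (AlgHom.op ((ψ : PolyExt n B →ₐ[k] PolyExt n B).comp (constHom k n B))) M ↔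
      ∀ (i : Fin n) (m : M), MulOpposite.op (ψ (var n B i)) • m = 0 := by
  constructor
  · intro h i m
    rw [h]
    simp
  · intro h r m
    obtain ⟨p, rfl⟩ := MulOpposite.op_surjective r
    obtain ⟨q, rfl⟩ := ψ.surjective p
    have key : ∀ x ∈ Ideal.span (Set.range (var n B)), ∀ m : M,
        MulOpposite.op (ψ x) • m = 0 := by
      intro x hx
      induction hx using Submodule.span_induction with
      | mem x hx => obtain ⟨i, rfl⟩ := hx; exact h i
      | zero => intro m; rw [map_zero, MulOpposite.op_zero, zero_smul]
      | add x y _ _ hx hy =>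
        intro m; rw [map_add, MulOpposite.op_add, add_smul, hx, hy, add_zero]
      | smul r x _ hx =>
        intro m; rw [smul_eq_mul, map_mul, MulOpposite.op_mul, mul_smul, hx]
    have := key _ (sub_constHom_constCoeff_mem (k := k) q) m
    rw [map_sub, MulOpposite.op_sub, sub_smul, sub_eq_zero] at this
    rw [this]
    simp

section Commutative

variable {C : Type u} [CommRing C] [Algebra k C]

theorem map_mk_nilradical_eq_zero_iff (p : PolyExt n C) :
    map n (Ideal.Quotient.mkₐ k (nilradical C)) p = 0 ↔ IsNilpotent p := by
  have h : IsNilpotent p ↔ ∀ m, IsNilpotent (p.coeff m) :=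
    MvPolynomial.isNilpotent_iff (σ := Fin n) (R := C) (P := p)
  rw [h, ← AddMonoidAlgebra.coeff_inj, DFunLike.ext_iff]
  refine forall_congr' fun m ↦ ?_
  rw [AddMonoidAlgebra.coeff_mapAlgHom]
  exact Ideal.Quotient.eq_zero_iff_mem.trans mem_nilradical

/-- Polynomials generate `C[t₁, …, tₙ]` over `C` if they do so modulo nilpotents. -/
theorem adjoin_eq_top_of_map_nilradical (s : Fin n → PolyExt n C)
    (h : Algebra.adjoin k ((const k n (C ⧸ nilradical C) : Set (PolyExt n (C ⧸ nilradical C))) ∪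
      Set.range fun i ↦ map n (Ideal.Quotient.mkₐ k (nilradical C)) (s i)) = ⊤) :
    Algebra.adjoin k ((const k n C : Set (PolyExt n C)) ∪ Set.range s) = ⊤ := by
  let ρ := map n (Ideal.Quotient.mkₐ k (nilradical C))
  let D := Algebra.adjoin k ((const k n C : Set (PolyExt n C)) ∪ Set.range s)
  have hconst : ∀ c, constHom k n C c ∈ D := fun c ↦ Algebra.subset_adjoin (.inl ⟨c, rfl⟩)
  have hmap : D.map ρ = ⊤ := by
    rw [eq_top_iff, ← h, Algebra.adjoin_le_iff]
    rintro _ (⟨c, rfl⟩ | ⟨i, rfl⟩)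
    · obtain ⟨c, rfl⟩ := Ideal.Quotient.mk_surjective c
      exact ⟨constHom k n C c, hconst c, map_constHom _ c⟩
    · exact ⟨s i, Algebra.subset_adjoin (.inr ⟨i, rfl⟩), rfl⟩
  -- `D` contains the constants, so it is also a subalgebra over `C`.
  let D' : Subalgebra C (MvPolynomial (Fin n) C) :=
    { D.toSubsemiring with algebraMap_mem' := hconst }
  have hD' : D' = ⊤ := by
    refine MvPolynomial.subalgebra_eq_top_of_sub_isNilpotent D' fun i ↦ ?_
    obtain ⟨d, hd, hdi⟩ : ρ (var n C i) ∈ D.map ρ := hmap ▸ Algebra.mem_top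
    refine ⟨d, hd, (map_mk_nilradical_eq_zero_iff (k := k) (var n C i - d)).mp ?_⟩
    rw [map_sub, sub_eq_zero]
    exact hdi.symm
  exact eq_top_iff.mpr fun p _ ↦ (hD' ▸ Algebra.mem_top : p ∈ D')

/-- Substitution of polynomials for the variables. -/
noncomputable def subst (k : Type v) [Field k] [Algebra k C] (s : Fin n → PolyExt n C) :
    PolyExt n C →ₐ[k] PolyExt n C :=
  (MvPolynomial.aeval (R := C) (S₁ := MvPolynomial (Fin n) C) s).restrictScalars k

@[simp]
theorem subst_constHom (s : Fin n → PolyExt n C) (c : C) :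
    subst k s (constHom k n C c) = constHom k n C c :=
  MvPolynomial.aeval_C (S₁ := MvPolynomial (Fin n) C) s c

@[simp]
theorem subst_var (s : Fin n → PolyExt n C) (i : Fin n) : subst k s (var n C i) = s i :=
  MvPolynomial.aeval_X (S₁ := MvPolynomial (Fin n) C) s i

/-- If `n` polynomials generate `C[t₁, …, tₙ]` over `C`, their substitution is invertible. -/
theorem exists_inverse_subst (s : Fin n → PolyExt n C)
    (h : Algebra.adjoin k ((const k n C : Set (PolyExt n C)) ∪ Set.range s) = ⊤) :
    ∃ w : Fin n → PolyExt n C,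
      (∀ i, subst k s (w i) = var n C i) ∧ ∀ i, subst k w (s i) = var n C i := by
  have hr : (subst k s).range = ⊤ := by
    rw [eq_top_iff, ← h, Algebra.adjoin_le_iff]
    rintro _ (⟨c, rfl⟩ | ⟨i, rfl⟩)
    · exact ⟨constHom k n C c, subst_constHom s c⟩
    · exact ⟨var n C i, subst_var s i⟩
  have hs : Function.Surjective (subst k s) := (AlgHom.range_eq_top _).mp hr
  exact MvPolynomial.exists_inverse_substitution (σ := Fin n) (C := C) s hs

end Commutative

/-- If the polynomials `s₁, …, sₙ` generate `Z[t₁, …, tₙ]` over `Z`, and `B` is an algebra over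
the commutative ring `Z`, then `tᵢ ↦ sᵢ` defines an automorphism of `B[t₁, …, tₙ]`. -/
theorem exists_algEquiv_map_var {Z : Type w} [CommRing Z] [Algebra k Z] {B : Type u} [Ring B]
    [Algebra k B] (ι : Z →ₐ[k] B) (hι : ∀ z, ι z ∈ Subalgebra.center k B) (s : Fin n → PolyExt n Z)
    (h : Algebra.adjoin k ((const k n Z : Set (PolyExt n Z)) ∪ Set.range s) = ⊤) :
    ∃ ψ : PolyExt n B ≃ₐ[k] PolyExt n B, ∀ i, ψ (var n B i) = map n ι (s i) := by
  obtain ⟨w, hw, hw'⟩ := exists_inverse_subst s h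
  -- The images of the `r i` are central in B[t], so evaluation there is defined. The inverse
  -- substitution `w` found over `Z` then also gives the inverse over `B`.
  let E (r : Fin n → PolyExt n Z) : PolyExt n B →ₐ[k] PolyExt n B :=
    eval (constHom k n B) fun i ↦ ⟨map n ι (r i), map_mem_center ι hι (r i)⟩
  have hvar : ∀ r i, E r (var n B i) = map n ι (r i) := fun r i ↦ eval_var _ _ i
  have hE : ∀ r p, E r (map n ι p) = map n ι (subst k r p) := by
    intro r p
    have : (E r).comp (map n ι) = (map n ι).comp (subst k r) := by
      refine hom_ext (fun a ↦ ?_) fun i ↦ ?_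
      · rw [AlgHom.comp_apply, AlgHom.comp_apply, subst_constHom, map_constHom, eval_constHom]
      · rw [AlgHom.comp_apply, AlgHom.comp_apply, subst_var, map_var, hvar]
    exact DFunLike.congr_fun this p
  have hinv : ∀ r r' : Fin n → PolyExt n Z,
      (∀ i, subst k r (r' i) = var n Z i) → (E r).comp (E r') = .id k _ := by
    intro r r' hr
    refine hom_ext (fun a ↦ ?_) fun i ↦ ?_
    · simp only [E, AlgHom.comp_apply, eval_constHom, AlgHom.id_apply]
    · rw [AlgHom.comp_apply, hvar, hE, hr, AlgHom.id_apply, map_var]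
  exact ⟨AlgEquiv.ofAlgHom (E s) (E w) (hinv s w hw) (hinv w s hw'), hvar s⟩

end PolyExt

/-! ### From detectability of the center to cancellation. -/

namespace PolyExt

variable {k : Type v} [Field k]

/-- Every isomorphism `Z[s₁, …, sₙ] ≅ C[t₁, …, tₙ]` with `n ≥ 1` and `C` commutative has the
property that `C` and the images of the `sᵢ` generate `C[t₁, …, tₙ]`. -/
def DetectableAmongCommutative (k : Type v) [Field k] (Z : Type u) [Ring Z] [Algebra k Z] : Prop :=
  ∀ n : ℕ, 1 ≤ n → ∀ (C : Type u) [CommRing C] [Algebra k C] (φ : PolyExt n Z ≃ₐ[k] PolyExt n C),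
    Algebra.adjoin k ((const k n C : Set (PolyExt n C)) ∪
      Set.range (fun i : Fin n ↦ φ (var n Z i))) = ⊤

/-- When φ(A) = B, the set in question is the image under φ of the standard generators of A[s]. -/
theorem _root_.StronglyRetractable.stronglyDetectable {A : Type u} [Ring A] [Algebra k A]
    (h : StronglyRetractable k A) : StronglyDetectable k A := by
  intro n hn B _ _ φ
  rw [← h n hn B φ]
  have h1 : ((const k n A).map (φ : PolyExt n A →ₐ[k] PolyExt n B) : Set (PolyExt n B)) ∪
      Set.range (fun i : Fin n ↦ φ (var n A i)) =
      (φ : PolyExt n A →ₐ[k] PolyExt n B) '' ((const k n A) ∪ Set.range (var n A)) := by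
    rw [Set.image_union, ← Set.range_comp]
    rfl
  rw [h1, ← AlgHom.map_adjoin, adjoin_const_union_range_var, Algebra.map_top,
    AlgHom.range_eq_top]
  exact φ.surjective

theorem DetectableAmongCommutative.congr {Z Z' : Type u} [Ring Z] [Algebra k Z] [Ring Z']
    [Algebra k Z'] (h : DetectableAmongCommutative k Z) (f : Z ≃ₐ[k] Z') :
    DetectableAmongCommutative k Z' := by
  intro n hn C _ _ φ
  have := h n hn C ((AddMonoidAlgebra.mapAlgEquiv k (Fin n →₀ ℕ) f).trans φ)
  have hv : ∀ i, AddMonoidAlgebra.mapAlgEquiv k (Fin n →₀ ℕ) f (var n Z i) = var n Z' i :=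
    map_var (f : Z →ₐ[k] Z')
  simpa only [AlgEquiv.trans_apply, hv] using this

/-- An isomorphism preserves nilpotents, which are the kernel of reducing coefficients modulo the
nilradical. It therefore descends to the reduced rings, and generation there lifts back.
Commutativity of `C` gives it a nilradical. -/
theorem detectableAmongCommutative_of_quotient_nilradical {Z : Type u} [CommRing Z] [Algebra k Z]
    (h : StronglyDetectable k (Z ⧸ nilradical Z)) : DetectableAmongCommutative k Z := by
  intro n hn C _ _ φ
  apply adjoin_eq_top_of_map_nilradical
  obtain ⟨φ', hφ'⟩ := φ.exists_map_of_surjective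
    (map n (Ideal.Quotient.mkₐ k (nilradical Z))) (map n (Ideal.Quotient.mkₐ k (nilradical C)))
    (map_surjective (Ideal.Quotient.mkₐ_surjective _ _))
    (map_surjective (Ideal.Quotient.mkₐ_surjective _ _)) fun x ↦ by
      rw [map_mk_nilradical_eq_zero_iff, map_mk_nilradical_eq_zero_iff,
        IsNilpotent.map_iff φ.injective]
  have := h n hn (C ⧸ nilradical C) φ'
  have hv : ∀ i, φ' (var n (Z ⧸ nilradical Z) i) =
      map n (Ideal.Quotient.mkₐ k (nilradical C)) (φ (var n Z i)) := fun i ↦ by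
    rw [← hφ', map_var]
  simpa only [hv] using this

section

variable {A : Type u} [Ring A] [Algebra k A]

theorem stronglyCancellative (h : DetectableAmongCommutative k (Subalgebra.center k A)) :
    StronglyCancellative k A := by
  rintro n hn B _ _ ⟨φ⟩
  let φc := Subalgebra.centerAlgEquivCongr φ
  have hφc : ∀ z, (φc z : PolyExt n B) = φ z := fun _ ↦ rfl
  let ω := ((centerEquiv k n A).trans φc).trans (centerEquiv k n B).symm
  obtain ⟨ψ, hψ⟩ := exists_algEquiv_map_var (Subalgebra.center k B).val Subtype.prop _
    (h n hn (Subalgebra.center k B) ω)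
  refine nonempty_algEquiv_of_map_var (φ.trans ψ.symm) fun i ↦ ?_
  rw [AlgEquiv.trans_apply, AlgEquiv.symm_apply_eq, hψ, ← coe_centerEquiv]
  simp only [ω, AlgEquiv.trans_apply, AlgEquiv.apply_symm_apply, hφc, coe_centerEquiv, map_var]

/-- No map A[s] → B[t] is available here, only the isomorphism of centers; `A` and `B` are reached
through the modules killed by the sᵢ and by their images ψ(tᵢ). -/
theorem stronglyMoritaCancellative (h : DetectableAmongCommutative k (Subalgebra.center k A)) :
    StronglyMoritaCancellative k A := by
  rintro n hn B _ _ ⟨⟨e⟩⟩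
  obtain ⟨ω₀, hω₀⟩ := ModuleCat.exists_center_algEquiv (k := k) e.eqv
  let cA := (centerEquiv k n A).trans (Subalgebra.centerOpEquiv k (PolyExt n A))
  let cB := (centerEquiv k n B).trans (Subalgebra.centerOpEquiv k (PolyExt n B))
  let ω := (cA.trans ω₀).trans cB.symm
  obtain ⟨ψ, hψ⟩ := exists_algEquiv_map_var (Subalgebra.center k B).val Subtype.prop _
    (h n hn (Subalgebra.center k B) ω)
  have hA : ∀ i, (cA (var n _ i) : (PolyExt n A)ᵐᵒᵖ) = MulOpposite.op (var n A i) := fun i ↦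
    congrArg MulOpposite.op (map_var _ i)
  have hB : ∀ i, MulOpposite.op (ψ (var n B i)) = (ω₀ (cA (var n _ i)) : (PolyExt n B)ᵐᵒᵖ) := by
    intro i
    have : cB (ω (var n _ i)) = ω₀ (cA (var n _ i)) := by
      simp only [ω, AlgEquiv.trans_apply, AlgEquiv.apply_symm_apply]
    rw [← this, hψ]
    rfl
  refine e.isMoritaEquivalent_retract
    (AlgHom.op ((constCoeff k n A).comp
      ((AlgEquiv.refl : PolyExt n A ≃ₐ[k] PolyExt n A).symm : PolyExt n A →ₐ[k] PolyExt n A)))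
    (AlgHom.op (((AlgEquiv.refl : PolyExt n A ≃ₐ[k] PolyExt n A) :
      PolyExt n A →ₐ[k] PolyExt n A).comp (constHom k n A))) (fun x ↦ ?_)
    (AlgHom.op ((constCoeff k n B).comp (ψ.symm : PolyExt n B →ₐ[k] PolyExt n B)))
    (AlgHom.op ((ψ : PolyExt n B →ₐ[k] PolyExt n B).comp (constHom k n B))) (fun x ↦ ?_) ?_
  · simp
  · simp
  · ext M
    refine (actsThrough_op_iff ψ (e.eqv.functor.obj M)).trans
      (Iff.trans ?_ (actsThrough_op_iff _ M).symm)
    refine forall_congr' fun i ↦ ?_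
    rw [hB, AlgEquiv.coe_refl, id_eq, ← hA]
    -- Annihilation by a central element is the vanishing of a morphism, which an equivalence
    -- preserves and reflects.
    have hz : ∀ {R : Type u} [Ring R] [Algebra k R] (z : Subalgebra.center k R)
        (N : ModuleCat.{u} R), (∀ m : N, (z : R) • m = 0) ↔ ModuleCat.centerAction z N = 0 :=
      fun z N ↦ ⟨fun h ↦ by ext m; exact h m, fun h m ↦ congrArg (fun f ↦ f.hom m) h⟩
    rw [hz, hz, ← hω₀, e.eqv.functor.map_eq_zero_iff]

end

end PolyExt

theorem theorem0p5 {k : Type v} [Field k] {A : Type u} [Ring A] [Algebra k A]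
    (h :
      (StronglyRetractable k (Subalgebra.center k A) ∨
        StronglyRetractable k
          (Subalgebra.center k A ⧸ nilradical (Subalgebra.center k A))) ∨
      (StronglyDetectable k (Subalgebra.center k A) ∨
        StronglyDetectable k
          (Subalgebra.center k A ⧸ nilradical (Subalgebra.center k A)))) :
    (StronglyCancellative k (Subalgebra.center k A) ∧
      StronglyMoritaCancellative k (Subalgebra.center k A)) ∧
    (StronglyCancellative k A ∧ StronglyMoritaCancellative k A) := by
  have hdet : StronglyDetectable k (Subalgebra.center k A) ∨
      StronglyDetectable k (Subalgebra.center k A ⧸ nilradical (Subalgebra.center k A)) := by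
    rcases h with (h | h) | h
    · exact .inl h.stronglyDetectable
    · exact .inr h.stronglyDetectable
    · exact h
  have hZ : PolyExt.DetectableAmongCommutative k (Subalgebra.center k A) := by
    rcases hdet with h | h
    · exact fun n hn C _ _ φ ↦ h n hn C φ
    · exact PolyExt.detectableAmongCommutative_of_quotient_nilradical h
  -- The commutative ring `Z` is its own center, so the results for `A` also apply to `Z`.
  have hZZ : PolyExt.DetectableAmongCommutative k
      (Subalgebra.center k (Subalgebra.center k A)) :=
    hZ.congr (Subalgebra.topEquiv.symm.trans
      (Subalgebra.equivOfEq _ _ (Subalgebra.center_eq_top k (Subalgebra.center k A)).symm))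
  exact ⟨⟨PolyExt.stronglyCancellative hZZ, PolyExt.stronglyMoritaCancellative hZZ⟩,
    PolyExt.stronglyCancellative hZ, PolyExt.stronglyMoritaCancellative hZ⟩
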